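/- Let $(\mathcal A;\mathcal E)$ be an exact category (in the sense of Quillen: $\mathcal A$ is additive and $\mathcal E$ is a class of kernel-cokernel pairs, called conflations, closed under isomorphism and satisfying the usual axioms on inflations and deflations). An ideal of $\mathcal A$ is an additive subbifunctor of $\mathrm{Hom}$. An ME-conflation $i\to a\to j$ of arrows is a morphism $(i,a,j)$ from a conflation $I_0\to A_0\to J_0$ to a conflation $I_1\to A_1\to J_1$ that factors as $(1_{I_0},a^1,j)$ followed by $(i,a^2,1_{J_1})$ through a conflation $I_0\to A\to J_1$; one then writes $a=i\star j$. Put $\mathrm{Ext}(j,i)=0$ if every ME-conflation $i\to a\to j$ as above is null-homotopic, that is, $a=m_1h+ge_0$ for some $h:A_0\to I_1$ and $g:J_0\to A_1$, where $m_1:I_1\to A_1$ and $e_0:A_0\to J_0$ are the given inflation and deflation. For an ideal $\mathcal I$ let $\mathcal I^\perp$ be the ideal of all morphisms $k$ with $\mathrm{Ext}(i,k)=0$ for every $i\in\mathcal I$. Let $\mathcal E\text{-inj}=\mathrm{Hom}^\perp$ be the ideal of injective morphisms. For ideals $\mathcal I,\mathcal J$ let $\mathcal I\diamond\mathcal J$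 be the smallest ideal that contains all extensions $i\star j$ with $i\in\mathcal I$ and $j\in\mathcal J$. A special $\mathcal I$-precover of an object $A$ is a morphism $i_1:C_1\to A$ in $\mathcal I$ that is the deflation of a conflation $K_1\to C_1\to A$ arising as the pushout of a conflation $K_0\to C_0\to A$ along a morphism $k:K_0\to K_1$ in $\mathcal I^\perp$; such a $k$ is called an $\mathcal I$-syzygy of $A$. The ideal $\mathcal I$ is special precovering if every object has a special $\mathcal I$-precover. An ideal $\mathcal J\subseteq\mathcal I^\perp$ is an $\mathcal I$-syzygy ideal if it contains an $\mathcal I$-syzygy of every object $A$. The category has enough injective morphisms if every object $A$ admits an inflation $A\to E$ that is an injective morphism. **Theorem.** Suppose that $(\mathcal A;\mathcal E)$ has enough injective morphisms, let $\mathcal I$ be a special precovering ideal, and let $\mathcal J\subseteq\mathcal I^\perp$ be an ideal. Then $\mathcal J$ is an $\mathcal I$-syzygy ideal if and only if $\mathcal J\diamond\mathcal E\text{-inj}=\mathcal I^\perp$. -/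

import Mathlib

open CategoryTheory CategoryTheory.Limits

universe v u

namespace IdealApprox

/-- An ideal of a preadditive category: a subgroup of every `Hom` group, such that the family is
stable under composition with arbitrary morphisms on both sides (an additive subbifunctor
of `Hom`). -/
@[ext]
structure MorphismIdeal (C : Type u) [Category.{v} C] [Preadditive C] where
  hom (X Y : C) : AddSubgroup (X ⟶ Y)
  comp_mem : ∀ {W X Y Z : C} (h : W ⟶ X) (g : X ⟶ Y) (f : Y ⟶ Z),
    g ∈ hom X Y → h ≫ g ≫ f ∈ hom W Z

namespace MorphismIdeal

variable {C : Type u} [Category.{v} C] [Preadditive C]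

/-- Inclusion of ideals. -/
instance : LE (MorphismIdeal C) where
  le I J := ∀ ⦃X Y : C⦄ (f : X ⟶ Y), f ∈ I.hom X Y → f ∈ J.hom X Y

/-- The ideal `Hom` of all morphisms. -/
def all (C : Type u) [Category.{v} C] [Preadditive C] : MorphismIdeal C where
  hom _ _ := ⊤
  comp_mem _ _ _ _ := AddSubgroup.mem_top _

/-- The smallest ideal containing a class `M` of morphisms: the intersection of all ideals
that contain `M`. -/
def span (M : MorphismProperty C) : MorphismIdeal C where
  hom X Y := ⨅ K : {K : MorphismIdeal C // ∀ ⦃A B : C⦄ (f : A ⟶ B), M f → f ∈ K.hom A B},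
    K.1.hom X Y
  comp_mem h g f hg := by
    rw [AddSubgroup.mem_iInf] at hg ⊢
    exact fun K => K.1.comp_mem h g f (hg K)

end MorphismIdeal

section Pairs

variable {C : Type u} [Category.{v} C] [Preadditive C] (P : ObjectProperty (ShortComplex C))

/-- The pair `A --m--> B --e--> D` belongs to the class `P` of short complexes. -/
def IsPairIn {A B D : C} (m : A ⟶ B) (e : B ⟶ D) : Prop :=
  ∃ w : m ≫ e = 0, P (ShortComplex.mk m e w)

/-- `m` is the first morphism of a pair in `P`. -/
def IsInflationIn {A B : C} (m : A ⟶ B) : Prop := ∃ (D : C) (e : B ⟶ D), IsPairIn P m e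

/-- `e` is the second morphism of a pair in `P`. -/
def IsDeflationIn {B D : C} (e : B ⟶ D) : Prop := ∃ (A : C) (m : A ⟶ B), IsPairIn P m e

end Pairs

/-- A (Quillen) exact structure on an additive category: a class of kernel-cokernel pairs, the
conflations, closed under isomorphism and satisfying the usual axioms on inflations (the first
morphisms of the conflations) and deflations (the second morphisms of the conflations). -/
structure ExactStructure (C : Type u) [Category.{v} C] [Preadditive C]
    [HasFiniteBiproducts C] where
  conflations : ObjectProperty (ShortComplex C)
  of_iso : ∀ {S T : ShortComplex C}, (S ≅ T) → conflations S → conflations T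
  isKernel : ∀ S : ShortComplex C, conflations S →
    Nonempty (IsLimit (KernelFork.ofι S.f S.zero))
  isCokernel : ∀ S : ShortComplex C, conflations S →
    Nonempty (IsColimit (CokernelCofork.ofπ S.g S.zero))
  id_inflation : ∀ A : C, IsInflationIn conflations (𝟙 A)
  id_deflation : ∀ A : C, IsDeflationIn conflations (𝟙 A)
  comp_inflation : ∀ {A B D : C} (m : A ⟶ B) (n : B ⟶ D),
    IsInflationIn conflations m → IsInflationIn conflations n →
      IsInflationIn conflations (m ≫ n)
  comp_deflation : ∀ {A B D : C} (e : A ⟶ B) (f : B ⟶ D),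
    IsDeflationIn conflations e → IsDeflationIn conflations f →
      IsDeflationIn conflations (e ≫ f)
  pushout_inflation : ∀ {A B A' : C} (m : A ⟶ B) (f : A ⟶ A'), IsInflationIn conflations m →
    ∃ (B' : C) (g : B ⟶ B') (m' : A' ⟶ B'),
      IsPushout m f g m' ∧ IsInflationIn conflations m'
  pullback_deflation : ∀ {B D D' : C} (e : B ⟶ D) (f : D' ⟶ D), IsDeflationIn conflations e →
    ∃ (B' : C) (g : B' ⟶ B) (e' : B' ⟶ D'),
      IsPullback g e' e f ∧ IsDeflationIn conflations e'

namespace ExactStructure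

variable {C : Type u} [Category.{v} C] [Preadditive C] [HasFiniteBiproducts C]
  (E : ExactStructure C)

/-- `A --m--> B --e--> D` is a conflation. -/
def IsConflation {A B D : C} (m : A ⟶ B) (e : B ⟶ D) : Prop := IsPairIn E.conflations m e

/-- `m` is an inflation. -/
def IsInflation {A B : C} (m : A ⟶ B) : Prop := IsInflationIn E.conflations m

/-- A mono-epi (ME) conflation `i ⟶ a ⟶ j` of arrows: a morphism `(i, a, j)` of conflations
```
I₀ --m₀--> A₀ --e₀--> J₀
|i         |a         |j
I₁ --m₁--> A₁ --e₁--> J₁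
```
that factors as `(𝟙, b, j)` followed by `(i, c, 𝟙)` through a conflation
`I₀ --m--> A --e--> J₁`. -/
structure IsMEConflation {I₀ I₁ A₀ A₁ J₀ J₁ : C} (i : I₀ ⟶ I₁) (a : A₀ ⟶ A₁) (j : J₀ ⟶ J₁)
    (m₀ : I₀ ⟶ A₀) (e₀ : A₀ ⟶ J₀) (m₁ : I₁ ⟶ A₁) (e₁ : A₁ ⟶ J₁) : Prop where
  top : E.IsConflation m₀ e₀
  bot : E.IsConflation m₁ e₁
  comm_left : m₀ ≫ a = i ≫ m₁
  comm_right : a ≫ e₁ = e₀ ≫ j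
  factor : ∃ (A : C) (m : I₀ ⟶ A) (e : A ⟶ J₁) (b : A₀ ⟶ A) (c : A ⟶ A₁),
    E.IsConflation m e ∧ m₀ ≫ b = m ∧ b ≫ e = e₀ ≫ j ∧ m ≫ c = i ≫ m₁ ∧ c ≫ e₁ = e ∧
      b ≫ c = a

/-- `a = i ⋆ j`: the arrow `a` is an extension of `j` by `i`. -/
def IsExtension {I₀ I₁ A₀ A₁ J₀ J₁ : C} (i : I₀ ⟶ I₁) (a : A₀ ⟶ A₁) (j : J₀ ⟶ J₁) : Prop :=
  ∃ (m₀ : I₀ ⟶ A₀) (e₀ : A₀ ⟶ J₀) (m₁ : I₁ ⟶ A₁) (e₁ : A₁ ⟶ J₁),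
    E.IsMEConflation i a j m₀ e₀ m₁ e₁

/-- The class `I ⋆ J` of all extensions `i ⋆ j` with `i` in `I` and `j` in `J`. -/
def starClass (I J : MorphismIdeal C) : MorphismProperty C := fun A₀ A₁ a =>
  ∃ (I₀ I₁ J₀ J₁ : C) (i : I₀ ⟶ I₁) (j : J₀ ⟶ J₁),
    i ∈ I.hom I₀ I₁ ∧ j ∈ J.hom J₀ J₁ ∧ E.IsExtension i (A₀ := A₀) (A₁ := A₁) a j

/-- The extension ideal `I ⋄ J`, generated by the extensions `i ⋆ j`, `i ∈ I` and `j ∈ J`. -/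
def diamond (I J : MorphismIdeal C) : MorphismIdeal C := MorphismIdeal.span (E.starClass I J)

/-- `Ext (j, i) = 0`: every ME-conflation `i ⟶ a ⟶ j` is null-homotopic. -/
def ExtOrthogonal {J₀ J₁ I₀ I₁ : C} (j : J₀ ⟶ J₁) (i : I₀ ⟶ I₁) : Prop :=
  ∀ ⦃A₀ A₁ : C⦄ (a : A₀ ⟶ A₁) (m₀ : I₀ ⟶ A₀) (e₀ : A₀ ⟶ J₀) (m₁ : I₁ ⟶ A₁) (e₁ : A₁ ⟶ J₁),
    E.IsMEConflation i a j m₀ e₀ m₁ e₁ →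
      ∃ (h : A₀ ⟶ I₁) (g : J₀ ⟶ A₁), a = h ≫ m₁ + e₀ ≫ g

variable {E} in
lemma IsConflation.mono {A B D : C} {m : A ⟶ B} {e : B ⟶ D} (h : E.IsConflation m e) :
    Mono m := by
  obtain ⟨w, h⟩ := h
  obtain ⟨hl⟩ := E.isKernel _ h
  exact Fork.IsLimit.mono hl

variable {E} in
lemma IsConflation.exists_desc {A B D T : C} {m : A ⟶ B} {e : B ⟶ D}
    (h : E.IsConflation m e) (f : B ⟶ T) (hf : m ≫ f = 0) : ∃ g : D ⟶ T, e ≫ g = f := by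
  obtain ⟨w, h⟩ := h
  obtain ⟨hc⟩ := E.isCokernel _ h
  obtain ⟨g, hg⟩ := CokernelCofork.IsColimit.desc' hc f hf
  exact ⟨g, hg⟩

variable {E} in
lemma IsConflation.epi {A B D : C} {m : A ⟶ B} {e : B ⟶ D} (h : E.IsConflation m e) :
    Epi e := by
  obtain ⟨w, h⟩ := h
  obtain ⟨hc⟩ := E.isCokernel _ h
  exact Cofork.IsColimit.epi hc

variable {E} in
/-- The pushout of a conflation along an arbitrary morphism. -/
lemma IsConflation.exists_pushout {A B D A' : C} {m : A ⟶ B} {e : B ⟶ D}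
    (h : E.IsConflation m e) (f : A ⟶ A') :
    ∃ (B' : C) (g : B ⟶ B') (m' : A' ⟶ B') (e' : B' ⟶ D),
      IsPushout m f g m' ∧ g ≫ e' = e ∧ E.IsConflation m' e' := by
  obtain ⟨B', g, m', sq, D', d, hd⟩ := E.pushout_inflation m f ⟨D, e, h⟩
  have hd' : E.IsConflation m' d := hd
  have hme : m ≫ e = 0 := h.choose
  have hmd : m' ≫ d = 0 := hd.choose
  let e' : B' ⟶ D := sq.desc e 0 (by simp [hme])
  have h1 : g ≫ e' = e := sq.inl_desc _ _ _
  have h2 : m' ≫ e' = 0 := sq.inr_desc _ _ _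
  have hepi := h.epi
  have hdepi := hd'.epi
  obtain ⟨p, hp⟩ := hd'.exists_desc e' h2
  obtain ⟨q, hq⟩ := h.exists_desc (g ≫ d) (by
    rw [← Category.assoc, sq.w, Category.assoc, hmd, comp_zero])
  have hq' : e' ≫ q = d := by
    apply sq.hom_ext
    · rw [← Category.assoc, h1, hq]
    · rw [← Category.assoc, h2, hmd, zero_comp]
  have hpq : p ≫ q = 𝟙 D' := by
    rw [← cancel_epi d, ← Category.assoc, hp, hq', Category.comp_id]
  have hqp : q ≫ p = 𝟙 D := by
    rw [← cancel_epi e, ← Category.assoc, hq, Category.assoc, hp, h1, Category.comp_id]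
  refine ⟨B', g, m', e', sq, h1, h2, ?_⟩
  let t : D' ≅ D := ⟨p, q, hpq, hqp⟩
  exact E.of_iso (S := ShortComplex.mk m' d hmd) (T := ShortComplex.mk m' e' h2)
    (ShortComplex.isoMk (Iso.refl _) (Iso.refl _) t (by simp) (by simp [t, hp]))
    hd.choose_spec

/-- `Ext (j, i) = 0` if and only if `i` extends along the pullback along `j` of every inflation
with source `I₀` whose cokernel is the target of `j`. -/
lemma extOrthogonal_iff {J₀ J₁ I₀ I₁ : C} (j : J₀ ⟶ J₁) (i : I₀ ⟶ I₁) :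
    E.ExtOrthogonal j i ↔
      ∀ ⦃A₀ A : C⦄ (m₀ : I₀ ⟶ A₀) (e₀ : A₀ ⟶ J₀) (m : I₀ ⟶ A) (e : A ⟶ J₁) (b : A₀ ⟶ A),
        E.IsConflation m₀ e₀ → E.IsConflation m e → m₀ ≫ b = m → b ≫ e = e₀ ≫ j →
          ∃ h : A₀ ⟶ I₁, m₀ ≫ h = i := by
  constructor
  · intro H A₀ A m₀ e₀ m e b h₀ h hm he
    obtain ⟨A₁, c, m₁, e₁, sq, he₁, h₁⟩ := h.exists_pushout i
    obtain ⟨k, g, hkg⟩ := H (b ≫ c) m₀ e₀ m₁ e₁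
      ⟨h₀, h₁, by rw [← Category.assoc, hm, sq.w], by rw [Category.assoc, he₁, he],
        A, m, e, b, c, h, hm, he, sq.w, he₁, rfl⟩
    have := h₁.mono
    refine ⟨k, ?_⟩
    rw [← cancel_mono m₁]
    have w₀ : m₀ ≫ e₀ = 0 := h₀.choose
    have := congrArg (fun t => m₀ ≫ t) hkg
    simp only [Preadditive.comp_add, ← Category.assoc, hm, w₀, zero_comp, add_zero] at this
    rw [← this, sq.w]
  · intro H A₀ A₁ a m₀ e₀ m₁ e₁ h
    obtain ⟨A, m, e, b, c, hc, hm, he, -, -, -⟩ := h.factor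
    obtain ⟨k, hk⟩ := H m₀ e₀ m e b h.top hc hm he
    obtain ⟨g, hg⟩ := h.top.exists_desc (a - k ≫ m₁) (by
      rw [Preadditive.comp_sub, h.comm_left, ← Category.assoc, hk, sub_self])
    exact ⟨k, g, by rw [hg]; abel⟩

/-- The right perpendicular ideal: all morphisms `i` such that `Ext (j, i) = 0` for every `j`
in `I`. -/
def perp (I : MorphismIdeal C) : MorphismIdeal C where
  hom X Y :=
    { carrier := {i | ∀ ⦃J₀ J₁ : C⦄ (j : J₀ ⟶ J₁), j ∈ I.hom J₀ J₁ → E.ExtOrthogonal j i}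
      zero_mem' := fun J₀ J₁ j _ =>
        (E.extOrthogonal_iff j _).2 fun _ _ _ _ _ _ _ _ _ _ _ => ⟨0, comp_zero⟩
      add_mem' := fun {i i'} hi hi' J₀ J₁ j hj =>
        (E.extOrthogonal_iff j _).2 fun A₀ A m₀ e₀ m e b h₀ h h1 h2 => by
          obtain ⟨k, hk⟩ := (E.extOrthogonal_iff j _).1 (hi j hj) m₀ e₀ m e b h₀ h h1 h2
          obtain ⟨k', hk'⟩ := (E.extOrthogonal_iff j _).1 (hi' j hj) m₀ e₀ m e b h₀ h h1 h2
          exact ⟨k + k', by rw [Preadditive.comp_add, hk, hk']⟩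
      neg_mem' := fun {i} hi J₀ J₁ j hj =>
        (E.extOrthogonal_iff j _).2 fun A₀ A m₀ e₀ m e b h₀ h h1 h2 => by
          obtain ⟨k, hk⟩ := (E.extOrthogonal_iff j _).1 (hi j hj) m₀ e₀ m e b h₀ h h1 h2
          exact ⟨-k, by rw [Preadditive.comp_neg, hk]⟩ }
  comp_mem := fun {W X Y Z} k i f hi J₀ J₁ j hj =>
    (E.extOrthogonal_iff j _).2 fun A₀ A m₀ e₀ m e b h₀ h h1 h2 => by
      obtain ⟨B₀, g₀, n₀, d₀, sq₀, hd₀, c₀⟩ := h₀.exists_pushout k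
      obtain ⟨B, g, n, d, sq, hd, cc⟩ := h.exists_pushout k
      have hw : m₀ ≫ b ≫ g = k ≫ n := by rw [← Category.assoc, h1, sq.w]
      have w₀ : n₀ ≫ d₀ = 0 := c₀.choose
      have w : n ≫ d = 0 := cc.choose
      obtain ⟨t, ht⟩ := (E.extOrthogonal_iff j _).1 (hi j hj) n₀ d₀ n d
        (sq₀.desc (b ≫ g) n hw) c₀ cc (sq₀.inr_desc _ _ _) (by
          apply sq₀.hom_ext
          · rw [← Category.assoc, sq₀.inl_desc, Category.assoc, hd, h2, ← Category.assoc, hd₀]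
          · rw [← Category.assoc, sq₀.inr_desc, w, ← Category.assoc, w₀, zero_comp])
      exact ⟨g₀ ≫ t ≫ f, by
        rw [← Category.assoc, sq₀.w, Category.assoc, ← Category.assoc n₀, ht]⟩

/-- The ideal of injective morphisms, the right perpendicular of the ideal of all morphisms. -/
def injectiveIdeal : MorphismIdeal C := E.perp (MorphismIdeal.all C)

/-- Every object is the source of an inflation that is an injective morphism. -/
def HasEnoughInjectiveMorphisms : Prop :=
  ∀ A : C, ∃ (Q : C) (e : A ⟶ Q), E.IsInflation e ∧ e ∈ E.injectiveIdeal.hom A Q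

/-- `p : C₁ ⟶ A` is a special `I`-precover of `A` with `I`-syzygy `k : K₀ ⟶ K₁`: `p` lies in `I`,
`k` lies in the right perpendicular of `I`, and `p` is the deflation of a conflation
`K₁ ⟶ C₁ ⟶ A` that is the pushout along `k` of a conflation `K₀ ⟶ C₀ ⟶ A`. -/
def IsSpecialPrecoverWith (I : MorphismIdeal C) {A C₁ K₀ K₁ : C} (p : C₁ ⟶ A) (k : K₀ ⟶ K₁) :
    Prop :=
  p ∈ I.hom C₁ A ∧ k ∈ (E.perp I).hom K₀ K₁ ∧
    ∃ (C₀ : C) (m₀ : K₀ ⟶ C₀) (e₀ : C₀ ⟶ A) (m₁ : K₁ ⟶ C₁) (c : C₀ ⟶ C₁),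
      E.IsConflation m₀ e₀ ∧ E.IsConflation m₁ p ∧ IsPushout m₀ k c m₁ ∧ c ≫ p = e₀

/-- Every object has a special `I`-precover. -/
def IsSpecialPrecovering (I : MorphismIdeal C) : Prop :=
  ∀ A : C, ∃ (C₁ K₀ K₁ : C) (p : C₁ ⟶ A) (k : K₀ ⟶ K₁), E.IsSpecialPrecoverWith I p k

/-- `J` is an `I`-syzygy ideal: it lies in the right perpendicular of `I` and contains an
`I`-syzygy of every object. -/
def IsSyzygyIdeal (I J : MorphismIdeal C) : Prop :=
  J ≤ E.perp I ∧
    ∀ A : C, ∃ (C₁ K₀ K₁ : C) (p : C₁ ⟶ A) (k : K₀ ⟶ K₁),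
      E.IsSpecialPrecoverWith I p k ∧ k ∈ J.hom K₀ K₁

end ExactStructure

end IdealApprox

namespace IdealApprox

namespace MorphismIdeal

variable {C : Type u} [Category.{v} C] [Preadditive C]

/-! The proof rests on an auxiliary ideal `syzygyAnnihilators J`. A morphism `k` kills the pullback
of a conflation along `x` exactly when `x` lifts through the deflation of the pushout along `k`; `k`
belongs to the auxiliary ideal when, for each conflation starting at its source, this holds for some
deflation `d` obtained by pushing out along a morphism of `J`. Injectivity gives `J ⋄ E-inj ≤
syzygyAnnihilators J` for every ideal `J`, and `J ≤ perp I` gives `syzygyAnnihilators J ≤ perp I`.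
If `J` is a syzygy ideal, each `k` in `perp I` factors through an extension of an injective
inflation by a syzygy in `J`, which closes the circle. Conversely, if `perp I` lies in the auxiliary
ideal, apply this to a syzygy `k` of `A`: the resulting `d` factors through a special precover, so
it is itself one, with syzygy in `J`. -/

lemma comp_left_mem (I : MorphismIdeal C) {W X Y : C} (h : W ⟶ X) {g : X ⟶ Y}
    (hg : g ∈ I.hom X Y) : h ≫ g ∈ I.hom W Y := by
  simpa using I.comp_mem h g (𝟙 Y) hg

lemma comp_right_mem (I : MorphismIdeal C) {X Y Z : C} {g : X ⟶ Y} (hg : g ∈ I.hom X Y)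
    (f : Y ⟶ Z) : g ≫ f ∈ I.hom X Z := by
  simpa using I.comp_mem (𝟙 X) g f hg

lemma subset_span (M : MorphismProperty C) {X Y : C} {f : X ⟶ Y} (hf : M f) :
    f ∈ (span M).hom X Y := by
  change f ∈ iInf _
  rw [AddSubgroup.mem_iInf]
  exact fun K => K.2 f hf

lemma span_le {M : MorphismProperty C} {K : MorphismIdeal C}
    (h : ∀ ⦃X Y : C⦄ (f : X ⟶ Y), M f → f ∈ K.hom X Y) : span M ≤ K := by
  intro X Y f hf
  change f ∈ iInf _ at hf
  rw [AddSubgroup.mem_iInf] at hf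
  exact hf ⟨K, h⟩

lemma le_antisymm' {I J : MorphismIdeal C} (h : I ≤ J) (h' : J ≤ I) : I = J := by
  ext X Y f
  exact ⟨fun hf => h f hf, fun hf => h' f hf⟩

end MorphismIdeal

namespace ExactStructure

variable {C : Type u} [Category.{v} C] [Preadditive C] [HasFiniteBiproducts C]
  {E : ExactStructure C}

/-! ### Pullbacks and composites of conflations -/

lemma IsConflation.w {A B D : C} {m : A ⟶ B} {e : B ⟶ D} (h : E.IsConflation m e) :
    m ≫ e = 0 := h.choose

lemma IsConflation.exists_lift {A B D T : C} {m : A ⟶ B} {e : B ⟶ D}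
    (h : E.IsConflation m e) (f : T ⟶ B) (hf : f ≫ e = 0) : ∃ g : T ⟶ A, g ≫ m = f := by
  obtain ⟨w, h⟩ := h
  obtain ⟨hl⟩ := E.isKernel _ h
  obtain ⟨g, hg⟩ := KernelFork.IsLimit.lift' hl f hf
  exact ⟨g, hg⟩

/-- The pullback of a conflation along an arbitrary morphism. -/
lemma IsConflation.of_isPullback {A B D P D' : C} {m : A ⟶ B} {e : B ⟶ D}
    (h : E.IsConflation m e) {g : P ⟶ B} {e' : P ⟶ D'} {f : D' ⟶ D}
    (sq : IsPullback g e' e f) {m' : A ⟶ P} (hg : m' ≫ g = m) (he : m' ≫ e' = 0) :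
    E.IsConflation m' e' := by
  -- The axiom yields only some pullback, with an unspecified kernel `K`; comparing both with the
  -- given data gives an isomorphism of short complexes.
  obtain ⟨P', g', e'', sq', K, κ, hκ⟩ := E.pullback_deflation e f ⟨A, m, h⟩
  have hκ' : E.IsConflation κ e'' := hκ
  have := h.mono
  have := hκ'.mono
  let φ := sq'.isoIsPullback _ _ sq
  have φ1 : φ.hom ≫ g = g' := sq'.isoIsPullback_hom_fst _ _ sq
  have φ2 : φ.hom ≫ e' = e'' := sq'.isoIsPullback_hom_snd _ _ sq
  obtain ⟨p, hp⟩ := h.exists_lift (κ ≫ g') (by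
    rw [Category.assoc, sq'.w, ← Category.assoc, hκ'.w, zero_comp])
  obtain ⟨q, hq⟩ := hκ'.exists_lift (m' ≫ φ.inv) (by
    rw [← φ2, Category.assoc, φ.inv_hom_id_assoc, he])
  have hpm : p ≫ m' = κ ≫ φ.hom := by
    apply sq.hom_ext
    · rw [Category.assoc, hg, hp, Category.assoc, φ1]
    · rw [Category.assoc, he, comp_zero, Category.assoc, φ2, hκ'.w]
  have hpq : p ≫ q = 𝟙 K := by
    rw [← cancel_mono κ, Category.assoc, hq, ← Category.assoc, hpm, Category.assoc,
      φ.hom_inv_id, Category.comp_id, Category.id_comp]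
  have hqp : q ≫ p = 𝟙 A := by
    rw [← cancel_mono m, Category.assoc, hp, ← Category.assoc, hq, ← φ1, Category.assoc,
      φ.inv_hom_id_assoc, hg, Category.id_comp]
  let t : K ≅ A := ⟨p, q, hpq, hqp⟩
  exact ⟨he, E.of_iso (S := ShortComplex.mk κ e'' hκ'.w) (T := ShortComplex.mk m' e' he)
    (ShortComplex.isoMk t φ (Iso.refl _) (by simpa [t] using hpm) (by simpa using φ2))
    hκ.choose_spec⟩

lemma IsConflation.exists_pullback {A B D D' : C} {m : A ⟶ B} {e : B ⟶ D}
    (h : E.IsConflation m e) (f : D' ⟶ D) :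
    ∃ (P : C) (g : P ⟶ B) (e' : P ⟶ D') (m' : A ⟶ P),
      IsPullback g e' e f ∧ m' ≫ g = m ∧ E.IsConflation m' e' := by
  obtain ⟨P, g, e', sq, -⟩ := E.pullback_deflation e f ⟨A, m, h⟩
  refine ⟨P, g, e', sq.lift m 0 (by rw [h.w, zero_comp]), sq, sq.lift_fst _ _ _, ?_⟩
  exact h.of_isPullback sq (sq.lift_fst _ _ _) (sq.lift_snd _ _ _)

/-- The composite of deflations is the deflation of some conflation. -/
lemma IsConflation.comp {A A' B D F : C} {m : A ⟶ B} {e : B ⟶ D} {m' : A' ⟶ D} {e' : D ⟶ F}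
    (h : E.IsConflation m e) (h' : E.IsConflation m' e') :
    ∃ (N : C) (n : N ⟶ B), E.IsConflation n (e ≫ e') :=
  E.comp_deflation e e' ⟨A, m, h⟩ ⟨A', m', h'⟩

/-! ### Annihilation as a lifting property -/

variable (E) in
/-- `k` annihilates the pullback along `x` of the pair `(m, e)`: the morphism `k` extends along
the inflation of every conflation which is the pullback of `(m, e)` along `x`. -/
def Annihilates {K M B X X₀ : C} (m : K ⟶ B) (e : B ⟶ X) (k : K ⟶ M) (x : X₀ ⟶ X) : Prop :=
  ∀ ⦃B₀ : C⦄ (m₀ : K ⟶ B₀) (e₀ : B₀ ⟶ X₀) (b : B₀ ⟶ B),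
    E.IsConflation m₀ e₀ → m₀ ≫ b = m → b ≫ e = e₀ ≫ x → ∃ h : B₀ ⟶ M, m₀ ≫ h = k

lemma mem_perp_iff {I : MorphismIdeal C} {K M : C} {k : K ⟶ M} :
    k ∈ (E.perp I).hom K M ↔
      ∀ ⦃X₀ X : C⦄ (x : X₀ ⟶ X), x ∈ I.hom X₀ X →
        ∀ ⦃B : C⦄ (m : K ⟶ B) (e : B ⟶ X), E.IsConflation m e → E.Annihilates m e k x := by
  constructor
  · intro H X₀ X x hx B m e h B₀ m₀ e₀ b h₀ h1 h2
    exact (E.extOrthogonal_iff x k).1 (H x hx) m₀ e₀ m e b h₀ h h1 h2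
  · intro H X₀ X x hx
    exact (E.extOrthogonal_iff x k).2 fun B₀ B m₀ e₀ m e b h₀ h h1 h2 =>
      H x hx m e h m₀ e₀ b h₀ h1 h2

/-- An injective morphism extends along every inflation. -/
lemma exists_extension_of_mem_injectiveIdeal {A B X Q : C} {q : A ⟶ Q}
    (hq : q ∈ E.injectiveIdeal.hom A Q) {m : A ⟶ B} {e : B ⟶ X} (h : E.IsConflation m e) :
    ∃ f : B ⟶ Q, m ≫ f = q :=
  mem_perp_iff.1 hq (𝟙 X) (AddSubgroup.mem_top _) m e h m e (𝟙 B) h (Category.comp_id _)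
    (by simp)

/-- A lift of `x` through the deflation of a pushout along `k` shows that `k` annihilates the
pullback along `x`. -/
lemma Annihilates.of_lift {K M B X X₀ B' : C} {m : K ⟶ B} {e : B ⟶ X} {k : K ⟶ M}
    {g : B ⟶ B'} {m' : M ⟶ B'} {e' : B' ⟶ X} (w : m ≫ g = k ≫ m') (hg : g ≫ e' = e)
    (h' : E.IsConflation m' e') (y : X₀ ⟶ B') : E.Annihilates m e k (y ≫ e') := by
  intro B₀ m₀ e₀ b h₀ h1 h2
  have := h'.mono
  obtain ⟨h, hh⟩ := h'.exists_lift (b ≫ g - e₀ ≫ y) (by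
    rw [Preadditive.sub_comp, Category.assoc, Category.assoc, hg, h2, sub_self])
  refine ⟨h, ?_⟩
  rw [← cancel_mono m', Category.assoc, hh, Preadditive.comp_sub, ← Category.assoc, h1, w,
    ← Category.assoc, h₀.w, zero_comp, sub_zero]

/-- Converse of `Annihilates.of_lift`: correcting the map from the pullback to `B'` by the extension
of `k` makes it vanish on `K`, so it descends to `X₀`. -/
lemma Annihilates.exists_lift {K M B X X₀ B' : C} {m : K ⟶ B} {e : B ⟶ X} {k : K ⟶ M}
    {x : X₀ ⟶ X} (H : E.Annihilates m e k x) (h : E.IsConflation m e)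
    {g : B ⟶ B'} {m' : M ⟶ B'} {e' : B' ⟶ X} (w : m ≫ g = k ≫ m') (hg : g ≫ e' = e)
    (w' : m' ≫ e' = 0) : ∃ y : X₀ ⟶ B', y ≫ e' = x := by
  obtain ⟨B₀, b, e₀, m₀, sq, h1, h₀⟩ := h.exists_pullback x
  obtain ⟨t, ht⟩ := H m₀ e₀ b h₀ h1 sq.w
  have := h₀.epi
  obtain ⟨y, hy⟩ := h₀.exists_desc (b ≫ g - t ≫ m') (by
    rw [Preadditive.comp_sub, ← Category.assoc, h1, ← Category.assoc, ht, w, sub_self])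
  refine ⟨y, ?_⟩
  rw [← cancel_epi e₀, ← Category.assoc, hy, Preadditive.sub_comp, Category.assoc, hg,
    Category.assoc, w', comp_zero, sub_zero, sq.w]

lemma Annihilates.precomp {K M B X X₀ Z : C} {m : K ⟶ B} {e : B ⟶ X} {k : K ⟶ M}
    {x : X₀ ⟶ X} (H : E.Annihilates m e k x) (h : E.IsConflation m e) (z : Z ⟶ X₀) :
    E.Annihilates m e k (z ≫ x) := by
  obtain ⟨B', g, m', e', sq, hg, h'⟩ := h.exists_pushout k
  obtain ⟨y, rfl⟩ := H.exists_lift h sq.w hg h'.w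
  rw [← Category.assoc]
  exact .of_lift sq.w hg h' _

lemma Annihilates.add {K M B X X₀ : C} {m : K ⟶ B} {e : B ⟶ X} {k k' : K ⟶ M}
    {x : X₀ ⟶ X} (H : E.Annihilates m e k x) (H' : E.Annihilates m e k' x) :
    E.Annihilates m e (k + k') x := by
  intro B₀ m₀ e₀ b h₀ h1 h2
  obtain ⟨t, rfl⟩ := H m₀ e₀ b h₀ h1 h2
  obtain ⟨t', rfl⟩ := H' m₀ e₀ b h₀ h1 h2
  exact ⟨t + t', Preadditive.comp_add _ _ _ _ _ _⟩

lemma Annihilates.postcomp {K M M' B X X₀ : C} {m : K ⟶ B} {e : B ⟶ X} {k : K ⟶ M}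
    {x : X₀ ⟶ X} (H : E.Annihilates m e k x) (f : M ⟶ M') :
    E.Annihilates m e (k ≫ f) x := by
  intro B₀ m₀ e₀ b h₀ h1 h2
  obtain ⟨t, rfl⟩ := H m₀ e₀ b h₀ h1 h2
  exact ⟨t ≫ f, (Category.assoc _ _ _).symm⟩

/-! ### The auxiliary ideal -/

variable (E) in
/-- The pair `K ⟶ B ⟶ X` becomes annihilated by `k` after pullback along the deflation of a
pushout of a conflation ending in `X` along a morphism of `J`. -/
def AnnihilatedBySyzygy (J : MorphismIdeal C) {K M B X : C} (m : K ⟶ B) (e : B ⟶ X)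
    (k : K ⟶ M) : Prop :=
  ∃ (N P L D : C) (n : N ⟶ P) (p : P ⟶ X) (j : N ⟶ L) (δ : P ⟶ D) (l : L ⟶ D) (d : D ⟶ X),
    E.IsConflation n p ∧ j ∈ J.hom N L ∧ IsPushout n j δ l ∧ δ ≫ d = p ∧
      E.IsConflation l d ∧ E.Annihilates m e k d

/-- The two deflations onto `X` are dominated by a third: the fibre product of `P` and `P'` over
`X`, pushed out along a morphism of `J` into `L ⊞ L'`, maps to both `D` and `D'` over `X`. -/
lemma AnnihilatedBySyzygy.add {J : MorphismIdeal C} {K M B X : C} {m : K ⟶ B} {e : B ⟶ X}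
    {k k' : K ⟶ M} (h : E.IsConflation m e) (H : E.AnnihilatedBySyzygy J m e k)
    (H' : E.AnnihilatedBySyzygy J m e k') : E.AnnihilatedBySyzygy J m e (k + k') := by
  obtain ⟨N, P, L, D, n, p, j, δ, l, d, hp, hj, sq, hδ, hd, H⟩ := H
  obtain ⟨N', P', L', D', n', p', j', δ', l', d', hp', hj', sq', hδ', hd', H'⟩ := H'
  obtain ⟨R, g, g', _, pb, _, hg'⟩ := hp.exists_pullback p'
  obtain ⟨N'', n'', hn⟩ := hg'.comp hp'
  obtain ⟨ν, hν⟩ := hp.exists_lift (n'' ≫ g) (by rw [Category.assoc, pb.w, hn.w])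
  obtain ⟨ν', hν'⟩ := hp'.exists_lift (n'' ≫ g') (by rw [Category.assoc, hn.w])
  have : HasBinaryBiproducts C := hasBinaryBiproducts_of_finite_biproducts C
  let J' : N'' ⟶ L ⊞ L' := (ν ≫ j) ≫ biprod.inl + (ν' ≫ j') ≫ biprod.inr
  have hJ' : J' ∈ J.hom N'' (L ⊞ L') :=
    add_mem (J.comp_right_mem (J.comp_left_mem _ hj) _)
      (J.comp_right_mem (J.comp_left_mem _ hj') _)
  obtain ⟨D'', δ'', l'', d'', sq'', hδ'', hd''⟩ := hn.exists_pushout J'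
  have e1 : n'' ≫ g ≫ δ = J' ≫ biprod.fst ≫ l := by
    simp only [J', ← Category.assoc, Preadditive.add_comp]
    simp [← hν, sq.w]
  have e2 : n'' ≫ g' ≫ δ' = J' ≫ biprod.snd ≫ l' := by
    simp only [J', ← Category.assoc, Preadditive.add_comp]
    simp [← hν', sq'.w]
  have f1 : sq''.desc (g ≫ δ) (biprod.fst ≫ l) e1 ≫ d = d'' := by
    apply sq''.hom_ext
    · rw [← Category.assoc, sq''.inl_desc, hδ'', Category.assoc, hδ, pb.w]
    · rw [← Category.assoc, sq''.inr_desc, hd''.w, Category.assoc, hd.w, comp_zero]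
  have f2 : sq''.desc (g' ≫ δ') (biprod.snd ≫ l') e2 ≫ d' = d'' := by
    apply sq''.hom_ext
    · rw [← Category.assoc, sq''.inl_desc, hδ'', Category.assoc, hδ']
    · rw [← Category.assoc, sq''.inr_desc, hd''.w, Category.assoc, hd'.w, comp_zero]
  refine ⟨N'', R, L ⊞ L', D'', n'', g' ≫ p', J', δ'', l'', d'', hn, hJ', sq'', hδ'', hd'', ?_⟩
  exact .add (f1 ▸ H.precomp h _) (f2 ▸ H'.precomp h _)

lemma AnnihilatedBySyzygy.postcomp {J : MorphismIdeal C} {K M M' B X : C} {m : K ⟶ B}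
    {e : B ⟶ X} {k : K ⟶ M} (H : E.AnnihilatedBySyzygy J m e k) (f : M ⟶ M') :
    E.AnnihilatedBySyzygy J m e (k ≫ f) := by
  obtain ⟨N, P, L, D, n, p, j, δ, l, d, hp, hj, sq, hδ, hd, H⟩ := H
  exact ⟨N, P, L, D, n, p, j, δ, l, d, hp, hj, sq, hδ, hd, H.postcomp f⟩

variable (E) in
/-- The ideal of all `k` such that every conflation starting in the source of `k` becomes
annihilated by `k` after pullback along the deflation of a pushout along a morphism of `J`. -/
def syzygyAnnihilators (J : MorphismIdeal C) : MorphismIdeal C where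
  hom K M :=
    { carrier := {k | ∀ ⦃B X : C⦄ (m : K ⟶ B) (e : B ⟶ X), E.IsConflation m e →
        E.AnnihilatedBySyzygy J m e k}
      zero_mem' := fun B X m e h => by
        obtain ⟨D, δ, l, d, sq, hδ, hd⟩ := h.exists_pushout (0 : K ⟶ K)
        exact ⟨K, B, K, D, m, e, 0, δ, l, d, h, zero_mem _, sq, hδ, hd,
          fun _ _ _ _ _ _ _ => ⟨0, comp_zero⟩⟩
      add_mem' := fun H H' B X m e h => (H m e h).add h (H' m e h)
      neg_mem' := fun {k} H B X m e h => by
        simpa using (H m e h).postcomp (-𝟙 M) }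
  comp_mem := fun h g f H B X m e hme => by
    obtain ⟨B', b, m', e', sq, hb, h'⟩ := hme.exists_pushout h
    rw [← Category.assoc]
    refine .postcomp ?_ f
    obtain ⟨N, P, L, D, n, p, j, δ, l, d, hp, hj, sqD, hδ, hd, H⟩ := H m' e' h'
    refine ⟨N, P, L, D, n, p, j, δ, l, d, hp, hj, sqD, hδ, hd, ?_⟩
    -- Pushing out along `h` and then along `g` computes the pushout along `h ≫ g`, so the lift of
    -- `d` for `g` also serves `h ≫ g`.
    obtain ⟨B'', b', m'', e'', sq', hb', h''⟩ := h'.exists_pushout g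
    obtain ⟨y, rfl⟩ := H.exists_lift h' sq'.w hb' h''.w
    refine .of_lift (g := b ≫ b') (m' := m'') ?_ (by rw [Category.assoc, hb', hb]) h'' y
    rw [← Category.assoc, sq.w, Category.assoc, sq'.w, Category.assoc]

/-! ### The inclusions between the ideals -/

/-- Since `j` is in `perp I`, every `x` in `I` factors through `d`, and annihilation passes from `d`
to `x`. -/
lemma syzygyAnnihilators_le_perp {I J : MorphismIdeal C} (hJ : J ≤ E.perp I) :
    E.syzygyAnnihilators J ≤ E.perp I := by
  intro K M k H
  rw [mem_perp_iff]
  intro X₀ X x hx B m e h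
  obtain ⟨N, P, L, D, n, p, j, δ, l, d, hp, hj, sq, hδ, hd, H⟩ := H m e h
  obtain ⟨y, rfl⟩ := (mem_perp_iff.1 (hJ j hj) x hx n p hp).exists_lift hp sq.w hδ hd.w
  exact H.precomp h y

lemma diamond_injectiveIdeal_le_syzygyAnnihilators (J : MorphismIdeal C) :
    E.diamond J E.injectiveIdeal ≤ E.syzygyAnnihilators J := by
  refine MorphismIdeal.span_le ?_
  rintro A₀ A₁ a ⟨I₀, I₁, J₀, J₁, i, q, hi, hq, m₀, e₀, m₁, e₁, ME⟩ B X n p h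
  obtain ⟨A, m, e, b, c, hA, -, hbe, hmc, -, hbc⟩ := ME.factor
  -- The only use of injectivity: `e₀ ≫ q` extends over `B`, so `A ⟶ J₁` can be pulled back to a
  -- deflation onto `B`.
  obtain ⟨f, hf⟩ := exists_extension_of_mem_injectiveIdeal
    (E.injectiveIdeal.comp_left_mem e₀ hq) h
  obtain ⟨P, α, β, _, pb, _, hβ⟩ := hA.exists_pullback f
  obtain ⟨N, n', hN⟩ := hβ.comp h
  obtain ⟨γ, hγ⟩ := h.exists_lift (n' ≫ β) (by rw [Category.assoc, hN.w])
  -- The two routes from `N` to `A` agree in `J₁`; their difference `ν` lands in `I₀`, and `ν ≫ i`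
  -- is the required morphism of `J`.
  obtain ⟨ν, hν⟩ := hA.exists_lift (γ ≫ b - n' ≫ α) (by
    rw [Preadditive.sub_comp, Category.assoc, hbe, ← hf, Category.assoc, pb.w,
      ← Category.assoc, hγ, Category.assoc, sub_self])
  obtain ⟨D, δ, l, d, sq, hδ, hd⟩ := hN.exists_pushout (ν ≫ i)
  obtain ⟨B₁, ω, n₁, p₁, sq₁, hω, h₁⟩ := h.exists_pushout a
  -- Compatibility needed to define the lift `D ⟶ B₁` of `d` through the pushout along `a`.
  have key : n' ≫ (β ≫ ω - α ≫ c ≫ n₁) = (ν ≫ i) ≫ m₁ ≫ n₁ := by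
    have hν' := congrArg (fun t => t ≫ c ≫ n₁) hν
    simp only [Preadditive.sub_comp, Category.assoc] at hν'
    rw [Preadditive.comp_sub, ← Category.assoc n' β, ← hγ, Category.assoc, sq₁.w, ← hbc,
      Category.assoc, ← hν', ← Category.assoc m, hmc]
    simp
  have hd' : sq.desc _ _ key ≫ p₁ = d := by
    apply sq.hom_ext
    · rw [← Category.assoc, sq.inl_desc, hδ, Preadditive.sub_comp, Category.assoc, hω]
      simp [h₁.w]
    · rw [← Category.assoc, sq.inr_desc, hd.w, Category.assoc, h₁.w, comp_zero]
  exact ⟨N, P, I₁, D, n', β ≫ p, ν ≫ i, δ, l, d, hN, J.comp_left_mem ν hi, sq, hδ, hd,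
    hd' ▸ .of_lift sq₁.w hω h₁ _⟩

lemma perp_le_diamond_injectiveIdeal {I J : MorphismIdeal C}
    (hE : E.HasEnoughInjectiveMorphisms) (hJ : E.IsSyzygyIdeal I J) :
    E.perp I ≤ E.diamond J E.injectiveIdeal := by
  intro X Y k hk
  obtain ⟨Q, ε, ⟨A, π, hεπ⟩, hε⟩ := hE X
  have hQ : E.IsConflation ε π := hεπ
  obtain ⟨C₁, K₀, K₁, p, s, ⟨hp, -, C₀, m₀, e₀, m₁, c, h₀, h₁, sq, hc⟩, hs⟩ := hJ.2 A
  obtain ⟨P, g, g', x, pb, hx, hP⟩ := hQ.exists_pullback p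
  -- As `p` is in `I`, `k` extends along `x`, so it suffices to treat `x`.
  obtain ⟨t, rfl⟩ := mem_perp_iff.1 hk p hp ε π hQ x g' g hP hx pb.w
  refine MorphismIdeal.comp_right_mem _ ?_ t
  obtain ⟨P₀, r, r', z, pb₀, hz, hP₀⟩ := h₀.exists_pullback π
  obtain ⟨R, u, u', w, pbR, hw, hR⟩ := hP₀.exists_pullback ε
  have w₁ : m₁ ≫ p = 0 := h₁.w
  let z₁ : K₁ ⟶ P := pb.lift 0 m₁ (by rw [zero_comp, w₁])
  have hP₁ : E.IsConflation z₁ g :=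
    h₁.of_isPullback pb.flip (pb.lift_snd _ _ _) (pb.lift_fst _ _ _)
  let φ : P₀ ⟶ P := pb.lift r' (r ≫ c) (by rw [Category.assoc, hc, pb₀.w])
  have φ1 : φ ≫ g = r' := pb.lift_fst _ _ _
  have φ2 : φ ≫ g' = r ≫ c := pb.lift_snd _ _ _
  have hzφ : z ≫ φ = s ≫ z₁ := by
    apply pb.hom_ext
    · simp [z₁, φ1, hP₀.w]
    · simp only [z₁, Category.assoc, φ2, pb.lift_snd]
      rw [← Category.assoc, hz, sq.w]
  have ME : E.starClass J E.injectiveIdeal (u ≫ φ) :=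
    ⟨K₀, K₁, X, Q, s, ε, hs, hε, w, u', z₁, g, hR, hP₁,
      by rw [← Category.assoc, hw, hzφ], by rw [Category.assoc, φ1, pbR.w],
      P₀, z, r', u, φ, hP₀, hw, pbR.w, hzφ, φ1, rfl⟩
  -- Because `ε ≫ π = 0`, the conflation ending in `X` splits; its section `σ` exhibits `x` as a
  -- composite with the extension `s ⋆ ε`.
  let σ₀ : X ⟶ P₀ := pb₀.lift 0 ε (by rw [zero_comp, hQ.w])
  let σ : X ⟶ R := pbR.lift σ₀ (𝟙 X) (by rw [pb₀.lift_snd, Category.id_comp])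
  have hσ : σ ≫ u ≫ φ = x := by
    rw [← Category.assoc, pbR.lift_fst]
    apply pb.hom_ext
    · rw [Category.assoc, φ1, pb₀.lift_snd, hx]
    · rw [Category.assoc, φ2, ← Category.assoc, pb₀.lift_fst, zero_comp, hP.w]
  rw [← hσ]
  exact MorphismIdeal.comp_left_mem _ σ (MorphismIdeal.subset_span _ ME)

lemma isSyzygyIdeal_of_perp_le {I J : MorphismIdeal C} (hI : E.IsSpecialPrecovering I)
    (hJ : J ≤ E.perp I) (h : E.perp I ≤ E.syzygyAnnihilators J) : E.IsSyzygyIdeal I J := by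
  refine ⟨hJ, fun A => ?_⟩
  obtain ⟨C₁, K₀, K₁, q, k, hq, hk, C₀, m₀, e₀, m₁, c, h₀, h₁, sq₀, hc⟩ := hI A
  obtain ⟨N, P, L, D, n, p, j, δ, l, d, hp, hj, sq, hδ, hd, H⟩ := h k hk m₀ e₀ h₀
  -- Now `d` equals `y ≫ q` with `q` in `I`, so it is a special precover with syzygy `j`.
  obtain ⟨y, rfl⟩ := H.exists_lift h₀ sq₀.w hc h₁.w
  exact ⟨D, N, L, y ≫ q, j, ⟨I.comp_left_mem y hq, hJ j hj, P, n, p, l, δ, hp, hd, sq, hδ⟩, hj⟩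

end ExactStructure

end IdealApprox

theorem mainTheorem10 {C : Type u} [Category.{v} C] [Preadditive C] [HasFiniteBiproducts C]
    (E : IdealApprox.ExactStructure C) (hE : E.HasEnoughInjectiveMorphisms)
    (I : IdealApprox.MorphismIdeal C) (hI : E.IsSpecialPrecovering I)
    (J : IdealApprox.MorphismIdeal C) (hJ : J ≤ E.perp I) :
    E.IsSyzygyIdeal I J ↔ E.diamond J E.injectiveIdeal = E.perp I := by
  have hle := IdealApprox.ExactStructure.diamond_injectiveIdeal_le_syzygyAnnihilators (E := E) J
  constructor
  · intro h
    refine IdealApprox.MorphismIdeal.le_antisymm' (fun X Y f hf => ?_)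
      (IdealApprox.ExactStructure.perp_le_diamond_injectiveIdeal hE h)
    exact IdealApprox.ExactStructure.syzygyAnnihilators_le_perp hJ f (hle f hf)
  · intro h
    exact IdealApprox.ExactStructure.isSyzygyIdeal_of_perp_le hI hJ (h ▸ hle)
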